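/- Consider bilinearly coupled saddle point problems $$\min_{x\in\mathbb R^n}\max_{y\in\mathbb R^m} F(x,y)=f(x)+x^\top A y-g(y),$$ and let $\mathcal B_0(L_{xy},R_x,R_y)$ be the class of those with $f,g$ real-valued, convex and lower semicontinuous, $\|A\|_2\le L_{xy}$, which have a saddle point $(x^*,y^*)$ with $\|x^*\|\le R_x$ and $\|y^*\|\le R_y$. Write $\mathrm{prox}_{\gamma f}(v)=\arg\min_z\, f(z)+\frac1{2\gamma}\|z-v\|^2$, and let $\Delta(x,y)=\max_{y'}F(x,y')-\min_{x'}F(x',y)$ be the duality gap. A deterministic proximal algorithm on $\mathbb R^n\times\mathbb R^m$ started at $(x^0,y^0)$ produces iterates $(x^k,y^k)$ and outputs $(\tilde x^k,\tilde y^k)$, $k\ge 1$, by $$(x^k,\tilde x^k)=\mathcal A_x^k\big(x^0,Ay^0,\dots,x^{k-1},Ay^{k-1};\ \mathrm{prox}_{\gamma_k f}(u^k)\big),\qquad (y^k,\tilde y^k)=\mathcal A_y^k\big(y^0,A^\top x^0,\dots,y^{k-1},A^\top x^{k-1};\ \mathrm{prox}_{\sigma_k g}(v^k)\big),$$ where $\mathcal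 A_x^k,\mathcal A_y^k$ are arbitrary deterministic maps, $u^k$ and the step size $\gamma_k>0$ are arbitrary deterministic functions of $x^0,Ay^0,\dots,x^{k-1},Ay^{k-1}$, and $v^k$ and $\sigma_k>0$ are arbitrary deterministic functions of $y^0,A^\top x^0,\dots,y^{k-1},A^\top x^{k-1}$; all these maps may depend on the parameters $L_{xy},R_x,R_y,\epsilon$. Put $(\tilde x^0,\tilde y^0)=(x^0,y^0)$. There is a universal constant $c>0$ such that for all $L_{xy},R_x,R_y,\epsilon>0$ and all sufficiently large dimensions $n,m$ (depending only on $L_{xy},R_x,R_y,\epsilon$) the following holds. For every deterministic proximal algorithm on $\mathbb R^n\times\mathbb R^m$ and every initial point $(x^0,y^0)$ there is a problem $F_\epsilon\in\mathcal B_0(L_{xy},R_x,R_y)$, for which the maximum and the minimum in the definition of $\Delta(x,y)$ are attained at all $(x,y)$, such that for every $k\ge 0$ $$\Delta(\tilde x^k,\tilde y^k)\le\epsilon\quad\Longrightarrow\quad k\ \ge\ c\,\frac{L_{xy}R_xR_y}{\epsilon}.$$ That is, $\Omega(L_{xy}R_xR_y/\epsilon)$ iterations are required to reduce the duality gap to $\epsilon$.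 -/

import Mathlib

open scoped InnerProductSpace

namespace ProxLower

/-- Euclidean space of dimension `n` (with the Euclidean norm). -/
abbrev E (n : ℕ) : Type := EuclideanSpace ℝ (Fin n)

/-- The data of a bilinearly coupled saddle point problem
`min_x max_y F(x, y) = f(x) + xᵀ A y - g(y)` with `x ∈ ℝⁿ`, `y ∈ ℝᵐ`.
The coupling matrix is the linear map `A : ℝᵐ → ℝⁿ`; its operator norm is the spectral norm
and its adjoint is the transpose. -/
structure BilinearProblem (n m : ℕ) where
  f : E n → ℝ
  g : E m → ℝ
  A : E m →L[ℝ] E n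

namespace BilinearProblem

variable {n m : ℕ}

/-- The objective `F(x, y) = f(x) + xᵀ A y - g(y)`. -/
noncomputable def F (P : BilinearProblem n m) (x : E n) (y : E m) : ℝ :=
  P.f x + ⟪x, P.A y⟫_ℝ - P.g y

/-- The class `B(L_xy, μ_x, μ_y)`. -/
structure MemB (P : BilinearProblem n m) (Lxy μx μy : ℝ) : Prop where
  lsc_f : LowerSemicontinuous P.f
  lsc_g : LowerSemicontinuous P.g
  convex_f : StrongConvexOn Set.univ μx P.f
  convex_g : StrongConvexOn Set.univ μy P.g
  norm_A : ‖P.A‖ ≤ Lxy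

/-- `(xs, ys)` is a saddle point of `F`. -/
def IsSaddlePoint (P : BilinearProblem n m) (xs : E n) (ys : E m) : Prop :=
  (∀ y, P.F xs y ≤ P.F xs ys) ∧ (∀ x, P.F xs ys ≤ P.F x ys)

/-- The class `B₀(L_xy, R_x, R_y)`. -/
structure MemB0 (P : BilinearProblem n m) (Lxy Rx Ry : ℝ) : Prop where
  memB : P.MemB Lxy 0 0
  saddle : ∃ xs ys, P.IsSaddlePoint xs ys ∧ ‖xs‖ ≤ Rx ∧ ‖ys‖ ≤ Ry

/-- The primal function `Φ(x) = sup_y F(x, y)`. -/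
noncomputable def primal (P : BilinearProblem n m) (x : E n) : EReal :=
  ⨆ y, (P.F x y : EReal)

/-- The dual function `Ψ(y) = inf_x F(x, y)`. -/
noncomputable def dual (P : BilinearProblem n m) (y : E m) : EReal :=
  ⨅ x, (P.F x y : EReal)

/-- The duality gap `Δ(x, y) = Φ(x) - Ψ(y)`. As `Φ > -∞` and `Ψ < +∞`, the difference is
never of the form `∞ - ∞`. -/
noncomputable def gap (P : BilinearProblem n m) (x : E n) (y : E m) : EReal :=
  P.primal x - P.dual y

/-- The maximum defining `Φ(x)` and the minimum defining `Ψ(y)` are attained for all `x`, `y`;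
in particular the duality gap is finite everywhere. -/
def GapAttained (P : BilinearProblem n m) : Prop :=
  (∀ x, ∃ y, IsMaxOn (P.F x) Set.univ y) ∧ (∀ y, ∃ x, IsMinOn (fun x' => P.F x' y) Set.univ x)

end BilinearProblem

/-- `prox_{γ h}(v) = argmin_z h(z) + ‖z - v‖² / (2γ)`. For `γ > 0` and `h` convex and lower
semicontinuous the minimizer exists and is unique. -/
noncomputable def prox {n : ℕ} (γ : ℝ) (h : E n → ℝ) (v : E n) : E n :=
  Classical.epsilon fun p =>
    IsMinOn (fun z => h z + 1 / (2 * γ) * ‖z - v‖ ^ 2) Set.univ p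

/-- A general deterministic proximal algorithm on `ℝⁿ × ℝᵐ`: arbitrary deterministic maps, where
index `k` stands for the `(k+1)`-st iteration. The `x`-maps see the history
`(x⁰, A y⁰), …, (xᵏ, A yᵏ)`, the `y`-maps see the history `(y⁰, Aᵀ x⁰), …, (yᵏ, Aᵀ xᵏ)`.
* `u`, `γ` choose the point and the (positive) step size of the proximal query for `f`;
* `X` turns the history and the answer of the query into the next iterate and the next output;
* `v`, `σ`, `Y` do the same for the `y`-block with the proximal operator of `g`. -/
structure ProxAlgorithm (n m : ℕ) where
  u : (k : ℕ) → (Fin (k + 1) → E n × E n) → E n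
  γ : (k : ℕ) → (Fin (k + 1) → E n × E n) → ℝ
  γ_pos : ∀ k h, 0 < γ k h
  X : (k : ℕ) → (Fin (k + 1) → E n × E n) → E n → E n × E n
  v : (k : ℕ) → (Fin (k + 1) → E m × E m) → E m
  σ : (k : ℕ) → (Fin (k + 1) → E m × E m) → ℝ
  σ_pos : ∀ k h, 0 < σ k h
  Y : (k : ℕ) → (Fin (k + 1) → E m × E m) → E m → E m × E m

namespace ProxAlgorithm

variable {n m : ℕ}

/-- New `x`-iterate and `x`-output from the history of the `x`-block. -/
noncomputable def stepX (a : ProxAlgorithm n m) (P : BilinearProblem n m) (k : ℕ)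
    (h : Fin (k + 1) → E n × E n) : E n × E n :=
  a.X k h (prox (a.γ k h) P.f (a.u k h))

/-- New `y`-iterate and `y`-output from the history of the `y`-block. -/
noncomputable def stepY (a : ProxAlgorithm n m) (P : BilinearProblem n m) (k : ℕ)
    (h : Fin (k + 1) → E m × E m) : E m × E m :=
  a.Y k h (prox (a.σ k h) P.g (a.v k h))

/-- `run a P x0 y0 k = ((xᵏ, x̃ᵏ), (yᵏ, ỹᵏ))`: iterates and outputs after `k` iterations of `a`
on the problem `P` from the initial solution `(x0, y0)`. -/
noncomputable def run (a : ProxAlgorithm n m) (P : BilinearProblem n m) (x0 : E n) (y0 : E m) :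
    ℕ → (E n × E n) × (E m × E m)
  | 0 => ((x0, x0), (y0, y0))
  | k + 1 =>
    (a.stepX P k fun i => ((run a P x0 y0 i).1.1, P.A (run a P x0 y0 i).2.1),
     a.stepY P k fun i =>
      ((run a P x0 y0 i).2.1, ContinuousLinearMap.adjoint P.A (run a P x0 y0 i).1.1))
termination_by k => k
decreasing_by all_goals exact i.isLt

/-- The output `x̃ᵏ`. -/
noncomputable def outX (a : ProxAlgorithm n m) (P : BilinearProblem n m) (x0 : E n) (y0 : E m)
    (k : ℕ) : E n :=
  (a.run P x0 y0 k).1.2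

/-- The output `ỹᵏ`. -/
noncomputable def outY (a : ProxAlgorithm n m) (P : BilinearProblem n m) (x0 : E n) (y0 : E m)
    (k : ℕ) : E m :=
  (a.run P x0 y0 k).2.2

end ProxAlgorithm

end ProxLower

namespace ProxLower

/-! The hard instance is a chain along which each iteration uncovers at most one new direction. Here
`f` depends on the chains only through `e 0` and `g` not at all, so further chain vectors can be
learnt only through `A`. Since `A` is bidiagonal, a `y` in the span of `w 0, …, w (j - 1)` yields
only `e 0, …, e j`, and similarly for the adjoint. An adversary therefore keeps the tail of both
chains undetermined and, in high dimension, turns it orthogonal to everything produced so far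
(`ProxAlgorithm.exists_resisting`); this replaces any span assumption on the algorithm.

If the output `x` after `k` steps is orthogonal to `e k`, testing the gap against `partialSum w s k`
and the saddle component `ramp K e t` shows that it is at least `μ / 2 * s ^ 2 * (K - k)`
(`hardProblem_le_of_gap_le`). The radii allow `μ / 2 * s ^ 2 = L * Rx * Ry / (4 * K ^ 2)`, so for `k
< K / 2` the gap exceeds `L * Rx * Ry / (8 * K)`, and `K` of order `L * Rx * Ry / ε` gives the
bound. The output `y` plays no role. -/

/-! ### Orthonormal chains and their extensions. -/

/-- The vectors `e 0, …, e (K - 1)` are orthonormal, and the remaining ones vanish. -/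
structure IsChain {n : ℕ} (K : ℕ) (e : ℕ → E n) : Prop where
  norm_eq : ∀ i < K, ‖e i‖ = 1
  orth : ∀ i j, i ≠ j → ⟪e i, e j⟫_ℝ = 0
  zero : ∀ i, K ≤ i → e i = 0

theorem IsChain.orthonormal {n K : ℕ} {e : ℕ → E n} (he : IsChain K e) :
    Orthonormal ℝ (fun i : Fin K => e i) :=
  ⟨fun i => he.norm_eq i i.2, fun i j hij => he.orth i j fun h => hij (Fin.ext h)⟩

theorem IsChain.norm_le {n K : ℕ} {e : ℕ → E n} (he : IsChain K e) (i : ℕ) : ‖e i‖ ≤ 1 := by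
  rcases lt_or_ge i K with h | h
  · exact (he.norm_eq i h).le
  · simp [he.zero i h]

theorem IsChain.shift_orth {n K : ℕ} {e : ℕ → E n} (he : IsChain K e) (i j : ℕ) (h : i ≠ j) :
    ⟪e (i + 1), e (j + 1)⟫_ℝ = 0 :=
  he.orth _ _ (by omega)

/-- Any initial segment of a chain can be continued orthogonally to a given finite set. -/
theorem IsChain.exists_extension {n K : ℕ} {e : ℕ → E n} (he : IsChain K e) (k : ℕ)
    (S : Finset (E n)) (hn : S.card + K + K ≤ n) :
    ∃ e' : ℕ → E n, IsChain K e' ∧ (∀ i < k, e' i = e i) ∧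
      ∀ i, k ≤ i → ∀ s ∈ S, ⟪e' i, s⟫_ℝ = 0 := by
  classical
  set T : Finset (E n) := S ∪ (Finset.range K).image e with hT
  set W : Submodule ℝ (E n) := Submodule.span ℝ (T : Set (E n)) with hW
  have hTcard : T.card ≤ S.card + K :=
    (Finset.card_union_le _ _).trans
      (Nat.add_le_add_left (Finset.card_image_le.trans (Finset.card_range K).le) _)
  have hWr : Module.finrank ℝ W ≤ S.card + K := (finrank_span_finset_le_card T).trans hTcard
  have hsum : Module.finrank ℝ W + Module.finrank ℝ Wᗮ = n := by
    rw [Submodule.finrank_add_finrank_orthogonal, finrank_euclideanSpace_fin]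
  -- The complement of `S` and the whole old chain has room for `K` new vectors, so the new tail can
  -- keep its indices.
  have hK : K ≤ Module.finrank ℝ Wᗮ := by omega
  let b := stdOrthonormalBasis ℝ Wᗮ
  have hb : ∀ i, ∀ s ∈ T, ⟪(b i : E n), s⟫_ℝ = 0 := fun i s hs =>
    (Submodule.mem_orthogonal' W _).1 (b i).2 s (Submodule.subset_span hs)
  have heT : ∀ i, ∀ j, ⟪(b i : E n), e j⟫_ℝ = 0 := by
    intro i j
    rcases lt_or_ge j K with h | h
    · exact hb i _ (Finset.mem_union_right _
        (Finset.mem_image_of_mem e (Finset.mem_range.2 h)))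
    · simp [he.zero j h]
  refine ⟨fun i => if i < k then e i else
    if h : i < K then (b ⟨i, h.trans_le hK⟩ : E n) else 0, ⟨?_, ?_, ?_⟩, ?_, ?_⟩
  · intro i hi
    by_cases h : i < k
    · simpa [h] using he.norm_eq i hi
    · simp only [h, if_false, hi, dif_pos]
      exact b.orthonormal.1 ⟨i, hi.trans_le hK⟩
  · intro i j hij
    by_cases h : i < k <;> by_cases h' : j < k
    · simpa [h, h'] using he.orth i j hij
    · by_cases hj : j < K
      · simp only [h, h', hj, if_true, if_false, dif_pos]
        rw [real_inner_comm]
        exact heT _ _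
      · simp [h', hj]
    · by_cases hi : i < K
      · simp only [h, h', hi, if_true, if_false, dif_pos]
        exact heT _ _
      · simp [h, hi]
    · by_cases hi : i < K <;> by_cases hj : j < K
      · simp only [h, h', hi, hj, if_false, dif_pos]
        have := b.orthonormal.2 (i := ⟨i, hi.trans_le hK⟩) (j := ⟨j, hj.trans_le hK⟩)
          (by simpa using hij)
        simpa using this
      all_goals simp [h, h', hi, hj]
  · intro i hi
    by_cases h : i < k
    · simpa [h] using he.zero i hi
    · simp [h, hi.not_gt]
  · intro i hi
    simp [hi]
  · intro i hi s hs
    by_cases h : i < K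
    · simp only [hi.not_gt, h, if_false, dif_pos]
      exact hb _ s (Finset.mem_union_left _ hs)
    · simp [hi.not_gt, h]

theorem exists_isChain {n K : ℕ} (hn : K ≤ n) : ∃ e : ℕ → E n, IsChain K e := by
  refine ⟨fun i => if h : i < K then
    EuclideanSpace.basisFun (Fin n) ℝ ⟨i, h.trans_le hn⟩ else 0, ?_, ?_, ?_⟩
  · intro i hi
    simp only [hi, dif_pos]
    exact (EuclideanSpace.basisFun (Fin n) ℝ).orthonormal.1 _
  · intro i j hij
    by_cases hi : i < K <;> by_cases hj : j < K
    · simp only [hi, hj, dif_pos]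
      exact (EuclideanSpace.basisFun (Fin n) ℝ).orthonormal.2 (by simpa using hij)
    all_goals simp [hi, hj]
  · intro i hi
    simp [hi.not_gt]

theorem norm_sq_sum_smul_of_orthogonal {n : ℕ} {v : ℕ → E n}
    (hv : ∀ i j, i ≠ j → ⟪v i, v j⟫_ℝ = 0) (s : Finset ℕ) (a : ℕ → ℝ) :
    ‖∑ i ∈ s, a i • v i‖ ^ 2 = ∑ i ∈ s, a i ^ 2 * ‖v i‖ ^ 2 := by
  rw [← real_inner_self_eq_norm_sq, sum_inner]
  refine Finset.sum_congr rfl fun i hi => ?_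
  rw [inner_sum, Finset.sum_eq_single i]
  · rw [real_inner_smul_left, real_inner_smul_right, real_inner_self_eq_norm_sq]
    ring
  · intro j _ hj
    rw [real_inner_smul_left, real_inner_smul_right, hv i j hj.symm]
    ring
  · exact fun h => absurd hi h

theorem norm_sum_inner_smul_le {n m K : ℕ} {w : ℕ → E m} (hw : IsChain K w) {v : ℕ → E n}
    (hv : ∀ i j, i ≠ j → ⟪v i, v j⟫_ℝ = 0) (hv1 : ∀ i, ‖v i‖ ≤ 1) (y : E m) :
    ‖∑ i ∈ Finset.range K, ⟪w i, y⟫_ℝ • v i‖ ≤ ‖y‖ := by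
  refine (pow_le_pow_iff_left₀ (norm_nonneg _) (norm_nonneg y) two_ne_zero).1 ?_
  rw [norm_sq_sum_smul_of_orthogonal hv]
  have hB : ∑ i : Fin K, ‖⟪w i, y⟫_ℝ‖ ^ 2 ≤ ‖y‖ ^ 2 :=
    hw.orthonormal.sum_inner_products_le y
  rw [Fin.sum_univ_eq_sum_range (fun i => ‖⟪w i, y⟫_ℝ‖ ^ 2) K] at hB
  refine le_trans (Finset.sum_le_sum fun i _ => ?_) hB
  rw [Real.norm_eq_abs, sq_abs]
  exact mul_le_of_le_one_right (sq_nonneg _) (pow_le_one₀ (norm_nonneg _) (hv1 i))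

/-! ### The bidiagonal coupling. -/

/-- The bidiagonal coupling `(L / 2) ∑ (e i - e (i + 1)) (w i)ᵀ`. -/
noncomputable def coupling {n m : ℕ} (L : ℝ) (K : ℕ) (e : ℕ → E n) (w : ℕ → E m) :
    E m →L[ℝ] E n :=
  (L / 2) • ∑ i ∈ Finset.range K, (innerSL ℝ (w i)).smulRight (e i - e (i + 1))

theorem coupling_apply {n m : ℕ} (L : ℝ) (K : ℕ) (e : ℕ → E n) (w : ℕ → E m) (y : E m) :
    coupling L K e w y = (L / 2) • ∑ i ∈ Finset.range K, ⟪w i, y⟫_ℝ • (e i - e (i + 1)) := by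
  simp [coupling]

theorem inner_coupling {n m : ℕ} (L : ℝ) (K : ℕ) (e : ℕ → E n) (w : ℕ → E m) (x : E n)
    (y : E m) :
    ⟪x, coupling L K e w y⟫_ℝ =
      L / 2 * ∑ i ∈ Finset.range K, ⟪w i, y⟫_ℝ * (⟪e i, x⟫_ℝ - ⟪e (i + 1), x⟫_ℝ) := by
  rw [coupling_apply, real_inner_smul_right, inner_sum]
  congr 1
  refine Finset.sum_congr rfl fun i _ => ?_
  rw [real_inner_smul_right, inner_sub_right, real_inner_comm x, real_inner_comm x]

theorem adjoint_coupling_apply {n m : ℕ} (L : ℝ) (K : ℕ) (e : ℕ → E n) (w : ℕ → E m)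
    (x : E n) :
    ContinuousLinearMap.adjoint (coupling L K e w) x =
      (L / 2) • ∑ i ∈ Finset.range K, (⟪e i, x⟫_ℝ - ⟪e (i + 1), x⟫_ℝ) • w i := by
  refine ext_inner_right ℝ fun y => ?_
  rw [ContinuousLinearMap.adjoint_inner_left, inner_coupling, real_inner_smul_left, sum_inner]
  congr 1
  refine Finset.sum_congr rfl fun i _ => ?_
  rw [real_inner_smul_left, mul_comm]

/-- Up to the factor `L / 2`, the coupling is a difference of two contractions (Bessel), one sending
`w i` to `e i`, the other to `e (i + 1)`. -/
theorem norm_coupling_le {n m K : ℕ} {L : ℝ} (hL : 0 ≤ L) {e : ℕ → E n} {w : ℕ → E m}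
    (he : IsChain K e) (hw : IsChain K w) : ‖coupling L K e w‖ ≤ L := by
  refine ContinuousLinearMap.opNorm_le_bound _ hL fun y => ?_
  rw [coupling_apply, norm_smul, Real.norm_eq_abs, abs_of_nonneg (by positivity)]
  simp only [smul_sub, Finset.sum_sub_distrib]
  have h1 := norm_sum_inner_smul_le hw he.orth he.norm_le y
  have h2 := norm_sum_inner_smul_le hw he.shift_orth (fun i => he.norm_le (i + 1)) y
  have h3 := norm_sub_le (∑ i ∈ Finset.range K, ⟪w i, y⟫_ℝ • e i)
    (∑ i ∈ Finset.range K, ⟪w i, y⟫_ℝ • e (i + 1))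
  nlinarith

/-! ### The hard instance, its saddle point and its gap. -/

/-- The hard instance attached to two chains. -/
noncomputable def hardProblem {n m : ℕ} (L R β μ : ℝ) (K : ℕ) (e : ℕ → E n) (w : ℕ → E m) :
    BilinearProblem n m where
  -- The squared excess makes every minimum over `x` attained, yet vanishes on the ball containing
  -- the saddle point and reveals no direction.
  f x := max (‖x‖ - R) 0 ^ 2 - β * ⟪e 0, x⟫_ℝ
  g y := μ / 2 * ‖y‖ ^ 2
  A := coupling L K e w

theorem BilinearProblem.le_of_gap_le {n m : ℕ} (P : BilinearProblem n m) {x : E n} {y : E m}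
    {ε : ℝ} (h : P.gap x y ≤ (ε : EReal)) (x' : E n) (y' : E m) :
    P.F x y' - P.F x' y ≤ ε := by
  have h1 : (P.F x y' : EReal) ≤ P.primal x := le_iSup (fun y => (P.F x y : EReal)) y'
  have h2 : P.dual y ≤ (P.F x' y : EReal) := iInf_le (fun x => (P.F x y : EReal)) x'
  have h3 := (EReal.sub_le_sub h1 h2).trans h
  exact_mod_cast h3

theorem exists_isMinOn_sq_excess_add_inner {n : ℕ} (R : ℝ) (b : E n) (d : ℝ) :
    ∃ x : E n, IsMinOn (fun x => max (‖x‖ - R) 0 ^ 2 + ⟪b, x⟫_ℝ + d) Set.univ x := by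
  have hc : Continuous fun x : E n => max (‖x‖ - R) 0 ^ 2 + ⟪b, x⟫_ℝ + d := by fun_prop
  obtain ⟨x, hx⟩ := hc.exists_forall_le (by
    -- With this `c`, the bound `p ^ 2 ≥ 2 * c * p - c ^ 2` for the excess `p` absorbs the linear
    -- term and leaves growth at least `‖x‖`.
    set c : ℝ := (‖b‖ + 1) / 2 with hcdef
    refine Filter.tendsto_atTop_mono (fun x => ?_) (Filter.tendsto_atTop_add_const_right _
      (d - (‖b‖ + 1) * R - c ^ 2) (tendsto_norm_cocompact_atTop (E := E n)))
    have h1 : ‖x‖ - R ≤ max (‖x‖ - R) 0 := le_max_left _ _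
    have h2 : -(‖b‖ * ‖x‖) ≤ ⟪b, x⟫_ℝ := (abs_le.1 (abs_real_inner_le_norm b x)).1
    have h3 : (‖b‖ + 1) * (‖x‖ - R) ≤ (‖b‖ + 1) * max (‖x‖ - R) 0 :=
      mul_le_mul_of_nonneg_left h1 (by positivity)
    have h4 := sq_nonneg (max (‖x‖ - R) 0 - c)
    have h5 : ‖b‖ + 1 = 2 * c := by rw [hcdef]; ring
    have h6 : ‖b‖ = 2 * c - 1 := by linarith
    rw [h5] at h3
    rw [h6] at h2
    rw [h5]
    nlinarith)
  exact ⟨x, fun y _ => hx y⟩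

theorem inner_sub_half_sq_le {m : ℕ} {μ : ℝ} (b y : E m) (hμ : 0 < μ) :
    ⟪b, y⟫_ℝ - μ / 2 * ‖y‖ ^ 2 ≤ ‖b‖ ^ 2 / (2 * μ) := by
  rw [le_div_iff₀ (by positivity)]
  have h1 := real_inner_le_norm b y
  nlinarith [sq_nonneg (‖b‖ - μ * ‖y‖)]

theorem convexOn_sq_excess {n : ℕ} (R : ℝ) :
    ConvexOn ℝ Set.univ fun x : E n => max (‖x‖ - R) 0 ^ 2 := by
  have h : ConvexOn ℝ Set.univ fun x : E n => max (‖x‖ - R) 0 :=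
    (convexOn_univ_norm.sub (concaveOn_const R convex_univ)).sup
      (convexOn_const 0 convex_univ)
  exact h.pow (fun x _ => le_max_right _ _) 2

section HardProblem

variable {n m K : ℕ} {L R β μ s t : ℝ} {e : ℕ → E n} {w : ℕ → E m}

theorem hardProblem_memB (hL : 0 ≤ L) (hμ : 0 ≤ μ) (he : IsChain K e) (hw : IsChain K w) :
    (hardProblem L R β μ K e w).MemB L 0 0 where
  lsc_f := Continuous.lowerSemicontinuous (by unfold hardProblem; fun_prop)
  lsc_g := Continuous.lowerSemicontinuous (by unfold hardProblem; fun_prop)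
  convex_f := by
    rw [strongConvexOn_zero]
    exact (convexOn_sq_excess R).sub
      (LinearMap.concaveOn (β • innerSL ℝ (e 0)).toLinearMap convex_univ)
  convex_g := by
    rw [strongConvexOn_zero]
    exact (convexOn_univ_norm.pow (fun _ _ => norm_nonneg _) 2).smul (by positivity)
  norm_A := norm_coupling_le hL he hw

theorem hardProblem_gapAttained (hμ : 0 < μ) : (hardProblem L R β μ K e w).GapAttained := by
  constructor
  · intro x
    set b := ContinuousLinearMap.adjoint (coupling L K e w) x with hb
    refine ⟨μ⁻¹ • b, fun y _ => ?_⟩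
    have key : ∀ y, (hardProblem L R β μ K e w).F x y =
        (hardProblem L R β μ K e w).f x + (⟪b, y⟫_ℝ - μ / 2 * ‖y‖ ^ 2) := by
      intro y
      rw [hb, ContinuousLinearMap.adjoint_inner_left, BilinearProblem.F]
      simp only [hardProblem]
      ring
    have h1 : ⟪b, μ⁻¹ • b⟫_ℝ - μ / 2 * ‖μ⁻¹ • b‖ ^ 2 = ‖b‖ ^ 2 / (2 * μ) := by
      rw [real_inner_smul_right, real_inner_self_eq_norm_sq, norm_smul, Real.norm_eq_abs,
        abs_of_pos (inv_pos.2 hμ)]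
      field_simp
      ring
    simp only [Set.mem_ofPred_eq, key, h1]
    linarith [inner_sub_half_sq_le b y hμ]
  · intro y
    obtain ⟨x, hx⟩ := exists_isMinOn_sq_excess_add_inner R
      (coupling L K e w y - β • e 0) (-(μ / 2 * ‖y‖ ^ 2))
    refine ⟨x, ?_⟩
    convert hx using 2 with x
    rw [BilinearProblem.F, inner_sub_left, real_inner_smul_left,
      real_inner_comm x (coupling L K e w y)]
    simp only [hardProblem]
    ring

/-- The sum of the first `k` vectors of a chain, scaled by `s`. -/
noncomputable def partialSum {m : ℕ} (w : ℕ → E m) (s : ℝ) (k : ℕ) : E m :=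
  ∑ i ∈ Finset.range k, s • w i

theorem norm_sq_partialSum (hw : IsChain K w) {k : ℕ} (hk : k ≤ K) :
    ‖partialSum w s k‖ ^ 2 = s ^ 2 * k := by
  rw [partialSum, norm_sq_sum_smul_of_orthogonal hw.orth _ fun _ => s]
  have h : ∀ i ∈ Finset.range k, s ^ 2 * ‖w i‖ ^ 2 = s ^ 2 := fun i hi => by
    rw [hw.norm_eq i ((Finset.mem_range.1 hi).trans_le hk), one_pow, mul_one]
  rw [Finset.sum_congr rfl h, Finset.sum_const, Finset.card_range, nsmul_eq_mul, mul_comm]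

theorem IsChain.inner_self (hw : IsChain K w) {i : ℕ} (hi : i < K) : ⟪w i, w i⟫_ℝ = 1 := by
  rw [real_inner_self_eq_norm_sq, hw.norm_eq i hi, one_pow]

theorem IsChain.inner_sum_smul (hw : IsChain K w) (a : ℕ → ℝ) {i k : ℕ} (hi : i < K) :
    ⟪w i, ∑ j ∈ Finset.range k, a j • w j⟫_ℝ = if i < k then a i else 0 := by
  rw [inner_sum]
  split_ifs with h
  · rw [Finset.sum_eq_single i]
    · rw [real_inner_smul_right, hw.inner_self hi, mul_one]
    · intro j _ hj
      rw [real_inner_smul_right, hw.orth i j hj.symm, mul_zero]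
    · exact fun h' => absurd (Finset.mem_range.2 h) h'
  · refine Finset.sum_eq_zero fun j hj => ?_
    have : i ≠ j := by have := Finset.mem_range.1 hj; omega
    rw [real_inner_smul_right, hw.orth i j this, mul_zero]

/-- The sum telescopes. For `k = K` the end term vanishes because `e K = 0`, so the coupling cancels
the linear part of `f`. -/
theorem inner_coupling_partialSum (hw : IsChain K w) {k : ℕ} (hk : k ≤ K) (x : E n) :
    ⟪x, coupling L K e w (partialSum w s k)⟫_ℝ = L / 2 * s * (⟪e 0, x⟫_ℝ - ⟪e k, x⟫_ℝ) := by
  rw [inner_coupling, ← Finset.sum_range_sub' (fun i => ⟪e i, x⟫_ℝ) k, mul_assoc,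
    Finset.mul_sum _ _ s]
  congr 1
  refine Eq.symm (Finset.sum_subset_zero_on_sdiff (Finset.range_subset_range.2 hk) ?_ ?_)
  · intro i hi
    rw [Finset.mem_sdiff, Finset.mem_range, Finset.mem_range] at hi
    rw [partialSum, hw.inner_sum_smul _ hi.1, if_neg hi.2, zero_mul]
  · intro i hi
    have hi := Finset.mem_range.1 hi
    rw [partialSum, hw.inner_sum_smul _ (hi.trans_le hk), if_pos hi]

theorem hardProblem_F_partialSum (hw : IsChain K w) {k : ℕ} (hk : k ≤ K) (x : E n)
    (hβ : β = L / 2 * s) :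
    (hardProblem L R β μ K e w).F x (partialSum w s k) =
      max (‖x‖ - R) 0 ^ 2 - β * ⟪e k, x⟫_ℝ - μ / 2 * (s ^ 2 * k) := by
  rw [BilinearProblem.F]
  simp only [hardProblem]
  rw [inner_coupling_partialSum hw hk, norm_sq_partialSum hw hk, hβ]
  ring

/-- The primal solution, with linearly decreasing coordinates along the chain. -/
noncomputable def ramp {n : ℕ} (K : ℕ) (e : ℕ → E n) (t : ℝ) : E n :=
  ∑ i ∈ Finset.range K, (t * (K - i)) • e i

theorem IsChain.inner_ramp (he : IsChain K e) {i : ℕ} (hi : i ≤ K) :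
    ⟪e i, ramp K e t⟫_ℝ = t * (K - i) := by
  rcases hi.lt_or_eq with h | rfl
  · rw [ramp, he.inner_sum_smul _ h, if_pos h]
  · rw [he.zero i le_rfl]
    simp

theorem IsChain.norm_ramp_le (he : IsChain K e) : ‖ramp K e t‖ ^ 2 ≤ t ^ 2 * K ^ 3 := by
  rw [ramp, norm_sq_sum_smul_of_orthogonal he.orth _ fun i : ℕ => t * ((K : ℝ) - i)]
  have : ∀ i ∈ Finset.range K, (t * ((K : ℝ) - i)) ^ 2 * ‖e i‖ ^ 2 ≤ t ^ 2 * K ^ 2 := by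
    intro i hi
    have hi := Finset.mem_range.1 hi
    have hi' : (i : ℝ) ≤ K := by exact_mod_cast hi.le
    rw [he.norm_eq i hi, one_pow, mul_one, mul_pow]
    have : ((K : ℝ) - i) ^ 2 ≤ K ^ 2 :=
      pow_le_pow_left₀ (by linarith) (by linarith [Nat.cast_nonneg (α := ℝ) i]) 2
    exact mul_le_mul_of_nonneg_left this (sq_nonneg t)
  refine (Finset.sum_le_sum this).trans (le_of_eq ?_)
  rw [Finset.sum_const, Finset.card_range, nsmul_eq_mul]
  ring

theorem hardProblem_F_ramp_le (he : IsChain K e) (hw : IsChain K w) (hμ : 0 < μ)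
    (hβ : β = L / 2 * s) (hs : μ * s = L / 2 * t) (hx : ‖ramp K e t‖ ≤ R) (hK : 0 < K) (y : E m) :
    (hardProblem L R β μ K e w).F (ramp K e t) y ≤ -(μ / 2 * (s ^ 2 * K)) := by
  -- Successive coordinates of the ramp differ by `t`, so its image under the adjoint is constant
  -- along `w`; `hs` is the optimality condition in `y`.
  have h1 : ⟪ramp K e t, coupling L K e w y⟫_ℝ = ⟪μ • partialSum w s K, y⟫_ℝ := by
    rw [inner_coupling, partialSum, real_inner_smul_left, sum_inner, Finset.mul_sum,
      Finset.mul_sum]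
    refine Finset.sum_congr rfl fun i hi => ?_
    have hi := Finset.mem_range.1 hi
    rw [he.inner_ramp hi.le, he.inner_ramp (i := i + 1) hi, real_inner_smul_left]
    push_cast
    linear_combination (-⟪w i, y⟫_ℝ) * hs
  have h2 := inner_sub_half_sq_le (μ • partialSum w s K) y hμ
  rw [norm_smul, Real.norm_eq_abs, abs_of_pos hμ, mul_pow, norm_sq_partialSum hw le_rfl] at h2
  have h3 : μ ^ 2 * (s ^ 2 * K) / (2 * μ) = μ / 2 * (s ^ 2 * K) := by
    field_simp
  have h4 : max (‖ramp K e t‖ - R) 0 = 0 := max_eq_right (by linarith)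
  have h5 : β * (t * (K - (0 : ℕ))) = μ * (s ^ 2 * K) := by
    rw [hβ]
    push_cast
    linear_combination (-s * K) * hs
  rw [BilinearProblem.F]
  simp only [hardProblem]
  rw [h1, h4, he.inner_ramp hK.le, h5]
  linarith

theorem hardProblem_memB0 {Ry : ℝ} (he : IsChain K e) (hw : IsChain K w) (hL : 0 ≤ L)
    (hμ : 0 < μ) (hβ : β = L / 2 * s) (hs : μ * s = L / 2 * t) (hx : ‖ramp K e t‖ ≤ R)
    (hy : ‖partialSum w s K‖ ≤ Ry) (hK : 0 < K) :
    (hardProblem L R β μ K e w).MemB0 L R Ry := by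
  have h1 : ∀ x, -(μ / 2 * (s ^ 2 * K)) ≤
      (hardProblem L R β μ K e w).F x (partialSum w s K) := by
    intro x
    rw [hardProblem_F_partialSum hw le_rfl x hβ, he.zero K le_rfl, inner_zero_left]
    linarith [sq_nonneg (max (‖x‖ - R) 0)]
  have h2 := hardProblem_F_ramp_le he hw hμ hβ hs hx hK
  exact ⟨hardProblem_memB hL hμ.le he hw, ramp K e t, partialSum w s K,
    ⟨fun y => (h2 y).trans (h1 _), fun x => (h2 _).trans (h1 x)⟩, hx, hy⟩

theorem hardProblem_le_of_gap_le {ε : ℝ} (he : IsChain K e) (hw : IsChain K w)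
    (hμ : 0 < μ) (hβ : β = L / 2 * s) (hs : μ * s = L / 2 * t) (hx : ‖ramp K e t‖ ≤ R)
    (hK : 0 < K) {k : ℕ} (hk : k ≤ K) {x : E n} {y : E m} (hxk : ⟪e k, x⟫_ℝ = 0)
    (h : (hardProblem L R β μ K e w).gap x y ≤ (ε : EReal)) :
    μ / 2 * s ^ 2 * (K - k) ≤ ε := by
  have h1 := BilinearProblem.le_of_gap_le _ h (ramp K e t) (partialSum w s k)
  rw [hardProblem_F_partialSum hw hk x hβ, hxk] at h1
  have h2 := hardProblem_F_ramp_le he hw hμ hβ hs hx hK y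
  nlinarith [sq_nonneg (max (‖x‖ - R) 0)]

/-! ### Locality of information and the resisting oracle. -/

theorem coupling_congr {e' : ℕ → E n} {w' : ℕ → E m} {k j : ℕ} (hj : j < k)
    (he : ∀ i < k, e' i = e i) (hw : ∀ i < k, w' i = w i) {y : E m}
    (h : ∀ i, j ≤ i → ⟪w i, y⟫_ℝ = 0) (h' : ∀ i, j ≤ i → ⟪w' i, y⟫_ℝ = 0) :
    coupling L K e w y = coupling L K e' w' y := by
  rw [coupling_apply, coupling_apply]
  congr 1
  refine Finset.sum_congr rfl fun i _ => ?_
  rcases lt_or_ge i j with hi | hi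
  -- The strict `j < k` is needed here: `i < j` gives `i + 1 < k`.
  · rw [he i (by omega), he (i + 1) (by omega), hw i (by omega)]
  · rw [h i hi, h' i hi, zero_smul, zero_smul]

theorem adjoint_coupling_congr {e' : ℕ → E n} {w' : ℕ → E m} {k j : ℕ} (hj : j < k)
    (he : ∀ i < k, e' i = e i) (hw : ∀ i < k, w' i = w i) {x : E n}
    (h : ∀ i, j ≤ i → ⟪e i, x⟫_ℝ = 0) (h' : ∀ i, j ≤ i → ⟪e' i, x⟫_ℝ = 0) :
    ContinuousLinearMap.adjoint (coupling L K e w) x =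
      ContinuousLinearMap.adjoint (coupling L K e' w') x := by
  rw [adjoint_coupling_apply, adjoint_coupling_apply]
  congr 1
  refine Finset.sum_congr rfl fun i _ => ?_
  rcases lt_or_ge i j with hi | hi
  · rw [he i (by omega), he (i + 1) (by omega), hw i (by omega)]
  · rw [h i hi, h' i hi, h (i + 1) (by omega), h' (i + 1) (by omega), sub_self, zero_smul,
      zero_smul]

end HardProblem

/-- Two problems that answer all queries made before iteration `k` alike produce the same
first `k` iterates. -/
theorem ProxAlgorithm.run_congr {n m : ℕ} (a : ProxAlgorithm n m) {P P' : BilinearProblem n m}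
    (x0 : E n) (y0 : E m) {k : ℕ} (hf : 0 < k → P.f = P'.f) (hg : P.g = P'.g)
    (hA : ∀ j < k, P.A (a.run P x0 y0 j).2.1 = P'.A (a.run P x0 y0 j).2.1)
    (hA' : ∀ j < k, ContinuousLinearMap.adjoint P.A (a.run P x0 y0 j).1.1 =
      ContinuousLinearMap.adjoint P'.A (a.run P x0 y0 j).1.1) :
    ∀ j ≤ k, a.run P' x0 y0 j = a.run P x0 y0 j := by
  intro j
  induction j using Nat.strong_induction_on with
  | _ j ih =>
    intro hj
    cases j with
    | zero => rw [run, run]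
    | succ j =>
      have hi : ∀ i : Fin (j + 1), a.run P' x0 y0 i = a.run P x0 y0 i := fun i =>
        ih i i.isLt (by omega)
      have h1 : (fun i : Fin (j + 1) => ((a.run P x0 y0 i).1.1, P'.A (a.run P x0 y0 i).2.1)) =
          fun i : Fin (j + 1) => ((a.run P x0 y0 i).1.1, P.A (a.run P x0 y0 i).2.1) :=
        funext fun i => by rw [hA i (by omega)]
      have h2 : (fun i : Fin (j + 1) => ((a.run P x0 y0 i).2.1,
          ContinuousLinearMap.adjoint P'.A (a.run P x0 y0 i).1.1)) =
          fun i : Fin (j + 1) => ((a.run P x0 y0 i).2.1,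
            ContinuousLinearMap.adjoint P.A (a.run P x0 y0 i).1.1) :=
        funext fun i => by rw [hA' i (by omega)]
      rw [run, run]
      simp only [hi, h1, h2, stepX, stepY, hf (by omega), hg]

/-- The resisting oracle: the `j`-th iterate and output are orthogonal to the vectors of the
chains from the `j`-th on. -/
theorem ProxAlgorithm.exists_resisting {n m : ℕ} (a : ProxAlgorithm n m) (x0 : E n) (y0 : E m)
    (L R β μ : ℝ) {K : ℕ} (hn : 4 * K ≤ n) (hm : 4 * K ≤ m) :
    ∀ k ≤ K, ∃ (e : ℕ → E n) (w : ℕ → E m), IsChain K e ∧ IsChain K w ∧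
      ∀ j < k, ∀ i, j ≤ i →
        ⟪e i, (a.run (hardProblem L R β μ K e w) x0 y0 j).1.1⟫_ℝ = 0 ∧
        ⟪e i, (a.run (hardProblem L R β μ K e w) x0 y0 j).1.2⟫_ℝ = 0 ∧
        ⟪w i, (a.run (hardProblem L R β μ K e w) x0 y0 j).2.1⟫_ℝ = 0 := by
  classical
  intro k
  induction k with
  | zero =>
    intro _
    obtain ⟨e, he⟩ := exists_isChain (K := K) (n := n) (by omega)
    obtain ⟨w, hw⟩ := exists_isChain (K := K) (n := m) (by omega)
    exact ⟨e, w, he, hw, fun j hj => absurd hj (Nat.not_lt_zero j)⟩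
  | succ k ih =>
    intro hk
    obtain ⟨e, w, he, hw, h⟩ := ih (by omega)
    set r := a.run (hardProblem L R β μ K e w) x0 y0 with hr
    set S : Finset (E n) := (Finset.range (k + 1)).image (fun j => (r j).1.1) ∪
      (Finset.range (k + 1)).image (fun j => (r j).1.2) with hS
    set T : Finset (E m) := (Finset.range (k + 1)).image (fun j => (r j).2.1) with hT
    have hScard : S.card ≤ (k + 1) + (k + 1) :=
      (Finset.card_union_le _ _).trans (Nat.add_le_add
        (Finset.card_image_le.trans (Finset.card_range _).le)
        (Finset.card_image_le.trans (Finset.card_range _).le))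
    have hTcard : T.card ≤ k + 1 := Finset.card_image_le.trans (Finset.card_range _).le
    obtain ⟨e', he', hee, heS⟩ := he.exists_extension k S (by omega)
    obtain ⟨w', hw', hww, hwT⟩ := hw.exists_extension k T (by omega)
    have hx : ∀ j ≤ k, ∀ i, j ≤ i → ⟪e' i, (r j).1.1⟫_ℝ = 0 ∧ ⟪e' i, (r j).1.2⟫_ℝ = 0 ∧
        ⟪w' i, (r j).2.1⟫_ℝ = 0 := by
      intro j hj i hij
      rcases lt_or_ge i k with hi | hi
      · rw [hee i hi, hww i hi]
        exact h j (by omega) i hij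
      · have hjr : j ∈ Finset.range (k + 1) := Finset.mem_range.2 (by omega)
        exact ⟨heS i hi _ (Finset.mem_union_left _ (Finset.mem_image_of_mem _ hjr)),
          heS i hi _ (Finset.mem_union_right _ (Finset.mem_image_of_mem _ hjr)),
          hwT i hi _ (Finset.mem_image_of_mem _ hjr)⟩
    have hrun : ∀ j ≤ k, a.run (hardProblem L R β μ K e' w') x0 y0 j = r j := by
      refine a.run_congr x0 y0 ?_ rfl ?_ ?_
      -- For `k = 0` even `e 0` is replaced, but no proximal query has been made yet.
      · intro hk0
        simp only [hardProblem, hee 0 hk0]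
      · intro j hj
        exact coupling_congr hj hee hww (fun i hi => (h j hj i hi).2.2)
          fun i hi => (hx j hj.le i hi).2.2
      · intro j hj
        exact adjoint_coupling_congr hj hee hww (fun i hi => (h j hj i hi).1)
          fun i hi => (hx j hj.le i hi).1
    refine ⟨e', w', he', hw', fun j hj i hij => ?_⟩
    rw [hrun j (by omega)]
    exact hx j (by omega) i hij

/-! ### Choice of parameters and the final bound. -/

/-- A steep quadratic whose minimizer differs from the initial point. -/
theorem exists_problem_initial_gap {n m : ℕ} (hn : 0 < n) {L Rx Ry ε : ℝ} (hL : 0 ≤ L)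
    (hRx : 0 < Rx) (hRy : 0 ≤ Ry) (hε : 0 < ε) (x0 : E n) (y0 : E m) :
    ∃ P : BilinearProblem n m, P.MemB0 L Rx Ry ∧ P.GapAttained ∧ ¬ P.gap x0 y0 ≤ (ε : EReal) := by
  obtain ⟨xs, hxs, hne⟩ : ∃ xs : E n, ‖xs‖ ≤ Rx ∧ xs ≠ x0 := by
    by_cases h : x0 = 0
    · refine ⟨EuclideanSpace.single (⟨0, hn⟩ : Fin n) Rx, ?_, ?_⟩
      · rw [PiLp.norm_single, Real.norm_eq_abs, abs_of_pos hRx]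
      · rw [h, ← norm_ne_zero_iff, PiLp.norm_single]
        simpa using hRx.ne'
    · exact ⟨0, by simpa using hRx.le, Ne.symm h⟩
  have hd : 0 < ‖x0 - xs‖ ^ 2 := by
    have := norm_pos_iff.2 (sub_ne_zero.2 hne.symm)
    positivity
  set M : ℝ := 2 * ε / ‖x0 - xs‖ ^ 2 with hM
  have hM0 : 0 < M := by positivity
  let P : BilinearProblem n m := ⟨fun x => M * ‖x - xs‖ ^ 2, fun y => ‖y‖ ^ 2, 0⟩
  have hF : ∀ x y, P.F x y = M * ‖x - xs‖ ^ 2 - ‖y‖ ^ 2 := by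
    intro x y
    simp [BilinearProblem.F, P]
  have hmax : ∀ x y, P.F x y ≤ P.F x 0 := by
    intro x y
    rw [hF, hF, norm_zero]
    linarith [sq_nonneg ‖y‖]
  have hmin : ∀ y x, P.F xs y ≤ P.F x y := by
    intro y x
    rw [hF, hF, sub_self, norm_zero]
    have : 0 ≤ M * ‖x - xs‖ ^ 2 := by positivity
    linarith
  refine ⟨P, ⟨⟨?_, ?_, ?_, ?_, ?_⟩, xs, 0, ⟨hmax xs, hmin 0⟩, hxs, by simpa using hRy⟩,
    ⟨fun x => ⟨0, fun y _ => hmax x y⟩, fun y => ⟨xs, fun x _ => hmin y x⟩⟩, fun h => ?_⟩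
  · exact Continuous.lowerSemicontinuous (by dsimp only [P]; fun_prop)
  · exact Continuous.lowerSemicontinuous (by dsimp only [P]; fun_prop)
  · rw [strongConvexOn_zero]
    have h1 : ConvexOn ℝ Set.univ fun x : E n => dist x xs := convexOn_univ_dist xs
    simp only [dist_eq_norm] at h1
    exact (h1.pow (fun _ _ => norm_nonneg _) 2).smul hM0.le
  · rw [strongConvexOn_zero]
    exact convexOn_univ_norm.pow (fun _ _ => norm_nonneg _) 2
  · simpa [P] using hL
  · have h1 := P.le_of_gap_le h xs 0
    rw [hF, hF, sub_self xs, norm_zero, norm_zero, hM, div_mul_cancel₀ _ hd.ne'] at h1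
    nlinarith [sq_nonneg ‖y0‖]

theorem exists_hard_problem {n m K : ℕ} (hK : 0 < K) (hn : 4 * K ≤ n) (hm : 4 * K ≤ m)
    {L Rx Ry : ℝ} (hL : 0 < L) (hRx : 0 < Rx) (hRy : 0 < Ry) (a : ProxAlgorithm n m)
    (x0 : E n) (y0 : E m) :
    ∃ P : BilinearProblem n m, P.MemB0 L Rx Ry ∧ P.GapAttained ∧
      ∀ (ε : ℝ), ∀ k < K, P.gap (a.outX P x0 y0 k) (a.outY P x0 y0 k) ≤ (ε : EReal) →
        L * Rx * Ry / (4 * K ^ 2) * (K - k) ≤ ε := by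
  have hK0 : (0 : ℝ) < K := by exact_mod_cast hK
  have hsqrt : √(K : ℝ) ^ 2 = K := Real.sq_sqrt hK0.le
  have hsp : 0 < √(K : ℝ) := Real.sqrt_pos.2 hK0
  -- `t` and `s` are as large as the norm bounds `t ^ 2 * K ^ 3` and `s ^ 2 * K` allow; `μ` is then
  -- forced by `μ * s = L / 2 * t`.
  set t : ℝ := Rx / (K * √K) with ht
  set s : ℝ := Ry / √K with hs
  set μ : ℝ := L * Rx / (2 * K * Ry) with hμ
  have hμ0 : 0 < μ := by positivity
  have hst : μ * s = L / 2 * t := by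
    rw [hμ, hs, ht]
    field_simp
  obtain ⟨e, w, he, hw, h⟩ := a.exists_resisting x0 y0 L Rx (L / 2 * s) μ hn hm K le_rfl
  have hx : ‖ramp K e t‖ ≤ Rx := by
    refine (pow_le_pow_iff_left₀ (norm_nonneg _) hRx.le two_ne_zero).1 (he.norm_ramp_le.trans ?_)
    rw [ht, div_pow, mul_pow, hsqrt]
    apply le_of_eq
    field_simp
  have hy : ‖partialSum w s K‖ ≤ Ry := by
    refine (pow_le_pow_iff_left₀ (norm_nonneg _) hRy.le two_ne_zero).1 ?_
    rw [norm_sq_partialSum hw le_rfl, hs, div_pow, hsqrt]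
    apply le_of_eq
    field_simp
  refine ⟨_, hardProblem_memB0 he hw hL.le hμ0 rfl hst hx hy hK, hardProblem_gapAttained hμ0,
    fun ε k hk hgap => ?_⟩
  have h1 := hardProblem_le_of_gap_le he hw hμ0 rfl hst hx hK hk.le (h k hk k le_rfl).2.1 hgap
  have h2 : L * Rx * Ry / (4 * (K : ℝ) ^ 2) = μ / 2 * s ^ 2 := by
    rw [hμ, hs, div_pow, hsqrt]
    field_simp
    norm_num
  rw [h2]
  exact h1

end ProxLower

theorem mainTheorem7 :
    ∃ c : ℝ, 0 < c ∧
      ∀ Lxy Rx Ry ε : ℝ, 0 < Lxy → 0 < Rx → 0 < Ry → 0 < ε →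
        ∃ N : ℕ, ∀ n m : ℕ, N ≤ n → N ≤ m →
          ∀ (a : ProxLower.ProxAlgorithm n m) (x0 : ProxLower.E n) (y0 : ProxLower.E m),
            ∃ P : ProxLower.BilinearProblem n m,
              P.MemB0 Lxy Rx Ry ∧ P.GapAttained ∧
                ∀ k : ℕ, P.gap (a.outX P x0 y0 k) (a.outY P x0 y0 k) ≤ (ε : EReal) →
                  c * (Lxy * Rx * Ry / ε) ≤ (k : ℝ) := by
  refine ⟨1 / 64, by norm_num, fun Lxy Rx Ry ε hL hRx hRy hε => ?_⟩
  set Q : ℝ := Lxy * Rx * Ry / ε with hQ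
  have hQ0 : 0 < Q := by positivity
  have hQε : Lxy * Rx * Ry = Q * ε := by
    rw [hQ]
    field_simp
  -- Below `64` the claimed bound is less than `1`, so only `k = 0` has to be excluded. Otherwise
  -- `K` is large enough that `k < Q / 64` implies `k < K / 2`.
  rcases lt_or_ge Q 64 with hsmall | hlarge
  · refine ⟨1, fun n m hn _ a x0 y0 => ?_⟩
    obtain ⟨P, h1, h2, h3⟩ :=
      ProxLower.exists_problem_initial_gap hn hL.le hRx hRy.le hε x0 y0
    refine ⟨P, h1, h2, fun k hk => ?_⟩
    cases k with
    | zero =>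
      rw [ProxLower.ProxAlgorithm.outX, ProxLower.ProxAlgorithm.outY,
        ProxLower.ProxAlgorithm.run] at hk
      exact absurd hk h3
    | succ k =>
      push_cast
      linarith [Nat.cast_nonneg (α := ℝ) k]
  · set K : ℕ := ⌊Q / 16⌋₊ with hKdef
    have hK1 : (K : ℝ) ≤ Q / 16 := Nat.floor_le (by positivity)
    have hK2 : Q / 16 < K + 1 := Nat.lt_floor_add_one _
    have hK3 : (0 : ℝ) < K := by linarith
    have hK4 : 0 < K := by exact_mod_cast hK3
    refine ⟨4 * K, fun n m hn hm a x0 y0 => ?_⟩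
    obtain ⟨P, h1, h2, h3⟩ := ProxLower.exists_hard_problem hK4 hn hm hL hRx hRy a x0 y0
    refine ⟨P, h1, h2, fun k hk => ?_⟩
    by_contra! hlt
    have hkK : (k : ℝ) < K / 2 := by linarith
    have hkK' : k < K := by
      have : (k : ℝ) < K := by linarith
      exact_mod_cast this
    have h4 := h3 ε k hkK' hk
    rw [hQε, div_mul_eq_mul_div, div_le_iff₀ (by positivity)] at h4
    have h5 : Q * ε * (K / 2) < Q * ε * (K - k) :=
      mul_lt_mul_of_pos_left (by linarith) (by positivity)
    have h6 : ε * K * K ≤ ε * K * (Q / 16) := mul_le_mul_of_nonneg_left hK1 (by positivity)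
    have h7 : 0 < ε * K * Q := by positivity
    nlinarith
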